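/- Let $n\ge 0$ be an integer, let $v=(v_0,\dots,v_n)$ and $a=(a_0,\dots,a_n)$ be sequences of non-negative integers such that $v_0>v_i$ for all $1\le i\le n$, and let $m\in\{1,\dots,n+1\}$. If $n=0$ and $v_0=0$, assume moreover that $a_0\ge 1$. Write $|a|=a_0+\cdots+a_n$, $v^{(0)}=(v_1,\dots,v_n)$, $a^{(0)}=(a_1,\dots,a_n)$, and write $u^+$ for the partition obtained by ordering the entries of a sequence $u$ of non-negative integers weakly decreasingly. Work over $\mathbb{C}(q)$, with $(z)_k=(z;q)_k=\prod_{i=0}^{k-1}(1-zq^i)$ and $$\begin{bmatrix} N\\ k\end{bmatrix}_q=\frac{(q^{N-k+1};q)_k}{(q;q)_k}\quad (N\in\mathbb{Z},\ k\ge 0),\qquad \begin{bmatrix} N\\ k\end{bmatrix}_q=0\quad (k<0).$$ For $N\ge 0$, $w\in\mathbb{Z}^N$, $b=(b_0,\dots,b_{N-1})$ a sequence of non-negative integers, $\lambda=(\lambda_0,\lambda_1,\dots)$ a partition and $0\le l\le N$, define $$D_{w,\lambda}(b,l)=\mathop{\mathrm{CT}}_{x}\; x^{-w}\,h_\lambda\big(x_l^{(b)}\big)\prod_{0\le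 i<j\le N-1}(x_i/x_j;q)_{b_i}\,(qx_j/x_i;q)_{b_j},$$ where $\mathrm{CT}_x$ is the constant term of a Laurent polynomial in $x=(x_0,\dots,x_{N-1})$, $x^w=x_0^{w_0}\cdots x_{N-1}^{w_{N-1}}$, $h_\lambda=\prod_i h_{\lambda_i}$ is the complete symmetric function, and $x_l^{(b)}$ is the alphabet of the $b_0+\cdots+b_{N-1}$ letters $x_iq^{k-\chi(i<l)}$ with $0\le i\le N-1$ and $0\le k\le b_i-1$, where $\chi(i<l)$ is $1$ if $i<l$ and $0$ otherwise. (For $N=0$ this gives $D=1$ when $\lambda$ is the empty partition.) Then $$D_{v,v^+}(a,m)=q^{a_1+\cdots+a_{m-1}-v_0}\begin{bmatrix} v_0+|a|-1\\ a_0-1\end{bmatrix}_q D_{v^{(0)},(v^{(0)})^+}\big(a^{(0)},m-1\big).$$ -/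

import Mathlib

noncomputable section

namespace QDyson

/-- The ground field `ℂ(q)`. -/
abbrev K : Type := RatFunc ℂ

/-- The indeterminate `q` of `ℂ(q)`. -/
def q : K := RatFunc.X

/-- The `q`-shifted factorial `(z; b)_k = (1 - z) (1 - z b) ⋯ (1 - z b ^ (k - 1))`. -/
def qPoch {R : Type*} [CommRing R] (z b : R) (k : ℕ) : R :=
  ∏ i ∈ Finset.range k, (1 - z * b ^ i)

/-- The `q`-binomial coefficient `[n choose k]_q = (q ^ (n - k + 1); q)_k / (q; q)_k` for an
integer `n` and `k ≥ 0`; it is `0` for `k < 0`. -/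
def qBinom (n k : ℤ) : K :=
  if 0 ≤ k then qPoch (q ^ (n - k + 1)) q k.toNat / qPoch q q k.toNat else 0

/-- Laurent polynomials over `ℂ(q)` in the variables `x_0, …, x_{N-1}`; an exponent vector
is a function `Fin N → ℤ`. -/
abbrev Laurent (N : ℕ) : Type := AddMonoidAlgebra K (Fin N → ℤ)

/-- The term `c x^e`. -/
def term {N : ℕ} (c : K) (e : Fin N → ℤ) : Laurent N := AddMonoidAlgebra.single e c

/-- The constant term with respect to all the variables. -/
def CT {N : ℕ} (f : Laurent N) : K := f.coeff 0

/-- The exponent vector of the variable `x_i`. -/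
def expo {N : ℕ} (i : Fin N) : Fin N → ℤ := Pi.single i 1

/-- The alphabet `x_m^{(a)}`. Its letters are indexed by pairs `(i, k)` with `0 ≤ k < a_i`; the
letter at `(i, k)` is `x_i q ^ (k - 1)` if `i < m`, and `x_i q ^ k` otherwise. -/
def alphabet {N : ℕ} (a : Fin N → ℕ) (m : ℕ) : (Σ i : Fin N, Fin (a i)) → Laurent N :=
  fun p => term (q ^ ((p.2.val : ℤ) - if p.1.val < m then 1 else 0)) (expo p.1)

/-- The value `h_λ(x_m^{(a)})` of the complete symmetric function indexed by a partition. -/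
def hAlphabet {N : ℕ} (a : Fin N → ℕ) (m : ℕ) {r : ℕ} (lam : r.Partition) : Laurent N :=
  MvPolynomial.aeval (alphabet a m)
    (MvPolynomial.hsymmPart (Σ i : Fin N, Fin (a i)) K lam)

/-- The `q`-Dyson product `∏_{i < j} (x_i / x_j; q)_{a_i} (q x_j / x_i; q)_{a_j}`. -/
def dysonProd {N : ℕ} (a : Fin N → ℕ) : Laurent N :=
  ∏ i : Fin N, ∏ j ∈ Finset.univ.filter (fun j : Fin N => i < j),
    (qPoch (term 1 (expo i - expo j)) (term q 0) (a i) *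
      qPoch (term q (expo j - expo i)) (term q 0) (a j))

/-- The constant term `D_{v,λ}(a, m)`. -/
def D {N : ℕ} (v : Fin N → ℤ) {r : ℕ} (lam : r.Partition) (a : Fin N → ℕ) (m : ℕ) : K :=
  CT (term 1 (-v) * hAlphabet a m lam * dysonProd a)

/-- The partition `v^+` obtained by sorting the composition `v` (zero parts are not recorded). -/
def plus {N : ℕ} (v : Fin N → ℕ) : (Multiset.map v Finset.univ.val).sum.Partition :=
  Nat.Partition.ofMultiset (Multiset.map v Finset.univ.val)

end QDyson

end

noncomputable section

namespace QDyson

open Finset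

/-! ### Complete symmetric functions: generating series and partial fractions. -/

section CompleteSymmetric

variable {σ : Type*} [Fintype σ] [DecidableEq σ]

/-! For distinct nonzero letters `y_p`, partial fractions give `h_r(y) = ∑_p y_p^r / ∏_{p' ≠ p} (1 -
y_{p'} / y_p)` (`aeval_hsymm_partialFractions`). Apply this with `r = v_0` to the factor `h_{v_0}`
and multiply by the `q`-Dyson product. For the letter `p = (j, l)` the denominator divides the
product, and the quotient `letterQuotient` is a Laurent polynomial with no negative power of `x_j`
(`map_letterQuotient_mul`, `letterQuotient_mem_ordGE`).

The summand of `(j, l)` thus carries `x_j^{v_0 - v_j}` times something of nonnegative order in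
`x_j`. For `j ≠ 0` the exponent is positive and the constant term vanishes (`CT_letter_eq_zero`).
For `j = 0` the order is nonnegative, so the constant term can be computed at `x_0 = 0`: the factors
linking `x_0` to the other variables become powers of `q`, the letters in `x_0` disappear, and the
smaller constant term remains (`CT_letter_zero`).

The scalars left over, summed over `l`, are the partial fraction expansion of `h_r(1, q, …, q^{a_0 -
1})` with `r = v_0 + a_1 + ⋯ + a_n`, which is the `q`-binomial coefficient
(`sum_q_powers_eq_qBinom`). -/

theorem aeval_hsymm {R : Type*} [CommRing R] [Algebra K R] (y : σ → R) (r : ℕ) :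
    MvPolynomial.aeval y (MvPolynomial.hsymm σ K r) =
      ∑ l ∈ finsuppAntidiag (univ : Finset σ) r, ∏ i, y i ^ l i := by
  rw [MvPolynomial.hsymm, map_sum]
  refine Finset.sum_bij' (fun s _ => Multiset.toFinsupp s.1)
    (fun l hl => ⟨Finsupp.toMultiset l, ?_⟩) ?_ ?_ ?_ ?_ ?_
  · rw [mem_finsuppAntidiag] at hl
    rw [Finsupp.card_toMultiset, Finsupp.sum_fintype _ _ (fun _ => rfl)]
    exact hl.1
  · intro s _
    simp only [mem_finsuppAntidiag, Finset.subset_univ, and_true, Multiset.toFinsupp_apply]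
    exact (Multiset.sum_count_eq_card (fun _ _ => mem_univ _)).trans s.2
  · intro l hl
    exact mem_univ _
  · intro s _
    exact Subtype.ext (by simp)
  · intro l hl
    simp
  · intro s _
    rw [map_multiset_prod, Multiset.map_map]
    simp only [Function.comp_def, MvPolynomial.aeval_X, Multiset.toFinsupp_apply]
    rw [Finset.prod_multiset_map_count]
    refine Finset.prod_subset (Finset.subset_univ _) fun i _ hi => ?_
    rw [Multiset.mem_toFinset] at hi
    rw [Multiset.count_eq_zero_of_notMem hi, pow_zero]

theorem geometric_mul {R : Type*} [CommRing R] (y : R) :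
    PowerSeries.mk (fun k => y ^ k) * (1 - PowerSeries.C y * PowerSeries.X) = 1 := by
  ext n
  rw [mul_sub, mul_one, ← mul_assoc, mul_comm _ (PowerSeries.C y), mul_assoc]
  cases n with
  | zero => simp
  | succ n => simp [PowerSeries.coeff_succ_mul_X, PowerSeries.coeff_one, pow_succ']

theorem mk_hsymm_mul {R : Type*} [CommRing R] [Algebra K R] (y : σ → R) :
    PowerSeries.mk (fun r => MvPolynomial.aeval y (MvPolynomial.hsymm σ K r)) *
      ∏ i, (1 - PowerSeries.C (y i) * PowerSeries.X) = 1 := by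
  have h : PowerSeries.mk (fun r => MvPolynomial.aeval y (MvPolynomial.hsymm σ K r)) =
      ∏ i, PowerSeries.mk (fun k => y i ^ k) := by
    ext r
    rw [PowerSeries.coeff_prod, PowerSeries.coeff_mk, aeval_hsymm]
    simp
  rw [h, ← Finset.prod_mul_distrib]
  exact Finset.prod_eq_one fun i _ => geometric_mul (y i)

theorem mk_hsymm_eq {R : Type*} [CommRing R] [Algebra K R] (y : σ → R) {G : PowerSeries R}
    (h : G * ∏ i, (1 - PowerSeries.C (y i) * PowerSeries.X) = 1) :
    PowerSeries.mk (fun r => MvPolynomial.aeval y (MvPolynomial.hsymm σ K r)) = G :=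
  left_inv_eq_right_inv (mk_hsymm_mul y) (by rw [mul_comm]; exact h)

/-- The generating series determines every `h_r`. The index types may differ, so letters equal to
zero can be discarded. -/
theorem aeval_hsymm_eq_of_prod_eq {τ : Type*} [Fintype τ] [DecidableEq τ] {R : Type*} [CommRing R] [Algebra K R]
    (y : σ → R) (z : τ → R)
    (h : ∏ i, (1 - PowerSeries.C (y i) * PowerSeries.X) =
      ∏ i, (1 - PowerSeries.C (z i) * PowerSeries.X)) (r : ℕ) :
    MvPolynomial.aeval y (MvPolynomial.hsymm σ K r) =
      MvPolynomial.aeval z (MvPolynomial.hsymm τ K r) := by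
  have := congrArg (PowerSeries.coeff r)
    (mk_hsymm_eq y (G := PowerSeries.mk
      (fun r => MvPolynomial.aeval z (MvPolynomial.hsymm τ K r))) (by rw [h, mk_hsymm_mul]))
  simpa using this

/-- The summands are the Lagrange basis polynomials at the nodes `1 / y_i`, and these add up to `1`.
-/
theorem partialFractions_one {F : Type*} [Field F] [Nonempty σ] (y : σ → F)
    (hy : Function.Injective y) (h0 : ∀ i, y i ≠ 0) :
    ∑ i, PowerSeries.C (∏ k ∈ univ.erase i, (1 - y k / y i))⁻¹ *
      ∏ k ∈ univ.erase i, (1 - PowerSeries.C (y k) * PowerSeries.X) = 1 := by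
  have hL := Lagrange.sum_basis (s := (univ : Finset σ)) (v := fun i => (y i)⁻¹)
    (fun i _ j _ hij => hy (inv_injective hij)) univ_nonempty
  have hL' := congrArg (Polynomial.coeToPowerSeries.ringHom (R := F)) hL
  rw [map_sum, map_one] at hL'
  refine Eq.trans ?_ hL'
  refine Finset.sum_congr rfl fun i _ => ?_
  rw [Lagrange.basis, map_prod, ← Finset.prod_inv_distrib, map_prod, ← Finset.prod_mul_distrib]
  refine Finset.prod_congr rfl fun k hk => ?_
  have hki : y k ≠ y i := fun h => (Finset.mem_erase.mp hk).1 (hy h)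
  have hk0 := h0 k
  have hi0 := h0 i
  have hs : y i - y k ≠ 0 := sub_ne_zero.mpr hki.symm
  have hs' : y k - y i ≠ 0 := sub_ne_zero.mpr hki
  rw [Lagrange.basisDivisor, map_mul, map_sub]
  simp only [Polynomial.coeToPowerSeries.ringHom_apply, Polynomial.coe_C, Polynomial.coe_X]
  have e1 : (1 - y k / y i)⁻¹ = ((y i)⁻¹ - (y k)⁻¹)⁻¹ * -(y k)⁻¹ := by
    have : (y i)⁻¹ - (y k)⁻¹ ≠ 0 := sub_ne_zero.mpr fun h => hki (inv_injective h).symm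
    have : 1 - y k / y i ≠ 0 := by
      rw [Ne, sub_eq_zero, eq_div_iff hi0, one_mul]; exact hki.symm
    field_simp
    ring
  rw [e1, map_mul, mul_assoc]
  congr 1
  rw [mul_sub, ← mul_assoc, ← map_mul, neg_mul, inv_mul_cancel₀ hk0]
  simp
  ring

/-- The partial fraction expansion of complete symmetric functions. -/
theorem aeval_hsymm_partialFractions {F : Type*} [Field F] [Algebra K F]
    (y : σ → F) (hy : Function.Injective y) (h0 : ∀ i, y i ≠ 0) (r : ℕ)
    (hr : 0 < r ∨ Nonempty σ) :
    MvPolynomial.aeval y (MvPolynomial.hsymm σ K r) =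
      ∑ i, (∏ k ∈ univ.erase i, (1 - y k / y i))⁻¹ * y i ^ r := by
  rcases isEmpty_or_nonempty σ with hσ | hσ
  -- With no letters, `h_r = 0` for `r > 0` agrees with the empty sum; `h_0 = 1` would not.
  · have hr' : 0 < r := hr.resolve_right (by simpa using hσ)
    have := congrArg (PowerSeries.coeff r) (mk_hsymm_eq y (G := 1) (by simp))
    simpa [PowerSeries.coeff_one, hr'.ne'] using this
  · have := congrArg (PowerSeries.coeff r) (mk_hsymm_eq y
      (G := ∑ i, PowerSeries.C (∏ k ∈ univ.erase i, (1 - y k / y i))⁻¹ *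
        PowerSeries.mk (fun k => y i ^ k)) ?_)
    · simpa using this
    · refine Eq.trans ?_ (partialFractions_one y hy h0)
      rw [Finset.sum_mul]
      refine Finset.sum_congr rfl fun i _ => ?_
      rw [mul_assoc, ← Finset.mul_prod_erase univ _ (mem_univ i), ← mul_assoc (PowerSeries.mk _),
        geometric_mul, one_mul]

end CompleteSymmetric

/-! ### Principal specialization and `q`-binomial coefficients. -/

section QBinomial

theorem q_ne_zero : q ≠ 0 := RatFunc.X_ne_zero

theorem q_pow_ne_one {k : ℕ} (hk : 0 < k) : q ^ k ≠ 1 := by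
  intro h
  have h' : algebraMap (Polynomial ℂ) (RatFunc ℂ) (Polynomial.X ^ k) =
      algebraMap (Polynomial ℂ) (RatFunc ℂ) 1 := by
    rw [map_pow, map_one, RatFunc.algebraMap_X]; exact h
  have := congrArg Polynomial.natDegree (RatFunc.algebraMap_injective ℂ h')
  simp at this
  omega

theorem q_zpow_eq_one {k : ℤ} (h : q ^ k = 1) : k = 0 := by
  by_contra hk
  rcases lt_or_gt_of_ne hk with hk | hk
  · refine q_pow_ne_one (k := (-k).toNat) (by omega) ?_
    rw [← zpow_natCast, Int.toNat_of_nonneg (by omega), zpow_neg, h, inv_one]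
  · refine q_pow_ne_one (k := k.toNat) (by omega) ?_
    rw [← zpow_natCast, Int.toNat_of_nonneg (by omega), h]

theorem q_zpow_injective : Function.Injective (fun k : ℤ => q ^ k) := by
  intro a b h
  have : q ^ (a - b) = 1 := by
    rw [zpow_sub₀ q_ne_zero]
    exact (div_eq_one_iff_eq (zpow_ne_zero _ q_ne_zero)).mpr h
  have := q_zpow_eq_one this
  omega

theorem qPoch_q_ne_zero (k : ℕ) : qPoch q q k ≠ 0 := by
  refine Finset.prod_ne_zero_iff.mpr fun i _ => sub_ne_zero.mpr fun h => ?_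
  rw [← pow_succ'] at h
  exact q_pow_ne_one (Nat.succ_pos i) h.symm

theorem qPoch_succ {R : Type*} [CommRing R] (z b : R) (k : ℕ) :
    qPoch z b (k + 1) = qPoch z b k * (1 - z * b ^ k) :=
  Finset.prod_range_succ _ _

theorem qPoch_succ' {R : Type*} [CommRing R] (z b : R) (k : ℕ) :
    qPoch z b (k + 1) = (1 - z) * qPoch (z * b) b k := by
  rw [qPoch, Finset.prod_range_succ', mul_comm]
  simp [qPoch, pow_succ', mul_assoc]

/-- The `q`-binomial theorem, by induction on `a`: multiplying by the new factor `1 - q^{a+1} X`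
lowers `a` by one, which on coefficients is the `q`-Pascal rule. -/
theorem mk_qBinomial_mul (a : ℕ) :
    PowerSeries.mk (fun r : ℕ => qPoch (q ^ (r + 1)) q a / qPoch q q a) *
      ∏ l ∈ range (a + 1), (1 - PowerSeries.C (q ^ l) * PowerSeries.X) = 1 := by
  induction a with
  | zero =>
    simpa [qPoch] using geometric_mul (1 : K)
  | succ a ih =>
    refine Eq.trans ?_ ih
    rw [Finset.prod_range_succ, mul_comm (∏ l ∈ _, _), ← mul_assoc]
    congr 1
    ext r
    rw [mul_sub, mul_one, mul_left_comm, mul_comm _ PowerSeries.X]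
    have hq := qPoch_q_ne_zero a
    have hq' := qPoch_q_ne_zero (a + 1)
    have hf : (1 - q ^ (a + 1)) ≠ 0 := by
      rw [qPoch_succ, ← pow_succ'] at hq'; exact right_ne_zero_of_mul hq'
    cases r with
    | zero =>
      simp [hq, hq']
    | succ r =>
      simp only [map_sub, PowerSeries.coeff_mk, PowerSeries.coeff_C_mul,
        PowerSeries.coeff_succ_X_mul]
      rw [qPoch_succ' (q ^ (r + 1)), qPoch_succ (q ^ (r + 1 + 1)), qPoch_succ q, ← pow_succ, ← pow_succ' q a]
      generalize qPoch (q ^ (r + 1 + 1)) q a = A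
      field_simp
      ring

theorem aeval_hsymm_q_powers (a r : ℕ) :
    MvPolynomial.aeval (fun l : Fin (a + 1) => q ^ (l : ℕ))
      (MvPolynomial.hsymm (Fin (a + 1)) K r) = qPoch (q ^ (r + 1)) q a / qPoch q q a := by
  have := congrArg (PowerSeries.coeff r) (mk_hsymm_eq (fun l : Fin (a + 1) => q ^ (l : ℕ))
    (G := PowerSeries.mk (fun r : ℕ => qPoch (q ^ (r + 1)) q a / qPoch q q a)) (by
      rw [Fin.prod_univ_eq_prod_range
        (fun l => (1 - PowerSeries.C (q ^ l) * PowerSeries.X : PowerSeries K))]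
      exact mk_qBinomial_mul a))
  simpa using this

/-- Both sides are `h_r(1, q, …, q^{a-1})`, once by partial fractions and once by the `q`-binomial
theorem. -/
theorem sum_q_powers_eq_qBinom (a r : ℕ) :
    ∑ l : Fin a, (∏ k ∈ univ.erase l, (1 - q ^ ((k : ℤ) - (l : ℤ))))⁻¹ * (q ^ (l : ℕ)) ^ r =
      qBinom (r + a - 1) (a - 1) := by
  cases a with
  -- The sum is empty, and the lower index `-1` makes the `q`-binomial zero, also when `r = 0`.
  | zero => simp [qBinom]
  | succ a =>
    have h := aeval_hsymm_partialFractions (fun l : Fin (a + 1) => q ^ (l : ℕ))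
      (fun k l h => by
        have := @q_zpow_injective (k : ℤ) (l : ℤ) (by simpa using h)
        exact Fin.ext (by exact_mod_cast this))
      (fun _ => pow_ne_zero _ q_ne_zero) r (Or.inr inferInstance)
    rw [aeval_hsymm_q_powers] at h
    have e1 : (r : ℤ) + ((a + 1 : ℕ) : ℤ) - 1 - (((a + 1 : ℕ) : ℤ) - 1) + 1 = ((r + 1 : ℕ) : ℤ) := by
      push_cast; ring
    have e2 : ((((a + 1 : ℕ) : ℤ) - 1)).toNat = a := by simp
    rw [qBinom, if_pos (by simp), e1, e2, zpow_natCast, h]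
    refine Finset.sum_congr rfl fun l _ => ?_
    congr 2
    refine Finset.prod_congr rfl fun k _ => ?_
    rw [zpow_sub₀ q_ne_zero, zpow_natCast, zpow_natCast]

end QBinomial

/-! ### Monomials and linearity of the constant term. -/

section Terms

variable {N : ℕ}

theorem term_mul_term (c d : K) (e f : Fin N → ℤ) : term c e * term d f = term (c * d) (e + f) :=
  AddMonoidAlgebra.single_mul_single e f c d

theorem term_one_zero : term 1 (0 : Fin N → ℤ) = 1 := rfl

theorem term_pow (c : K) (e : Fin N → ℤ) (k : ℕ) : term c e ^ k = term (c ^ k) (k • e) :=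
  AddMonoidAlgebra.single_pow e c k

theorem CT_sub (f g : Laurent N) : CT (f - g) = CT f - CT g := rfl

theorem CT_smul (c : K) (f : Laurent N) : CT (c • f) = c * CT f := rfl

theorem CT_sum {ι : Type*} (s : Finset ι) (f : ι → Laurent N) :
    CT (∑ i ∈ s, f i) = ∑ i ∈ s, CT (f i) := by
  simp [CT, AddMonoidAlgebra.coeff_sum]

theorem term_ne_zero {c : K} (hc : c ≠ 0) (e : Fin N → ℤ) : term c e ≠ 0 :=
  AddMonoidAlgebra.single_ne_zero.mpr hc

theorem term_injective {c d : K} {e f : Fin N → ℤ} (hc : c ≠ 0) (h : term c e = term d f) :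
    e = f ∧ c = d := by
  rcases AddMonoidAlgebra.single_inj.mp h with h | h
  · exact h
  · exact absurd h.1 hc

theorem map_qPoch {R S : Type*} [CommRing R] [CommRing S] (f : R →+* S) (z b : R) (k : ℕ) :
    f (qPoch z b k) = qPoch (f z) (f b) k := by
  simp [qPoch, map_prod]

end Terms

/-! ### Order of vanishing in one variable. -/

section Order

variable {N : ℕ}

/-- The Laurent polynomials all of whose exponents of `x_j` are at least `c`. -/
def ordGE (j : Fin N) (c : ℤ) : Submodule K (Laurent N) where
  carrier := {f | ∀ e, f.coeff e ≠ 0 → c ≤ e j}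
  zero_mem' := fun e h => absurd rfl h
  add_mem' := by
    intro f g hf hg e h
    by_contra hc
    have h1 : f.coeff e = 0 := by
      by_contra h1; exact hc (hf e h1)
    have h2 : g.coeff e = 0 := by
      by_contra h2; exact hc (hg e h2)
    exact h (by rw [AddMonoidAlgebra.coeff_add, Finsupp.add_apply, h1, h2, add_zero])
  smul_mem' := by
    intro c f hf e h
    refine hf e fun h1 => h ?_
    rw [AddMonoidAlgebra.coeff_smul, Finsupp.smul_apply, h1, smul_zero]

theorem ordGE_mono {j : Fin N} {c d : ℤ} (h : c ≤ d) {f : Laurent N} (hf : f ∈ ordGE j d) :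
    f ∈ ordGE j c := fun e he => h.trans (hf e he)

theorem term_mem_ordGE {j : Fin N} {c : ℤ} (k : K) {e : Fin N → ℤ} (h : c ≤ e j) :
    term k e ∈ ordGE j c := by
  classical
  intro e' he'
  rw [term, AddMonoidAlgebra.coeff_single, Finsupp.single_apply] at he'
  by_cases hee : e = e'
  · exact hee ▸ h
  · rw [if_neg hee] at he'; exact absurd rfl he'

theorem mul_mem_ordGE {j : Fin N} {c d : ℤ} {f g : Laurent N} (hf : f ∈ ordGE j c)
    (hg : g ∈ ordGE j d) : f * g ∈ ordGE j (c + d) := by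
  classical
  intro e he
  obtain ⟨e₁, h₁, e₂, h₂, rfl⟩ := Finset.mem_add.mp
    (AddMonoidAlgebra.support_coeff_mul_subset f g (Finsupp.mem_support_iff.mpr he))
  exact add_le_add (hf e₁ (Finsupp.mem_support_iff.mp h₁)) (hg e₂ (Finsupp.mem_support_iff.mp h₂))

theorem one_mem_ordGE (j : Fin N) : (1 : Laurent N) ∈ ordGE j 0 :=
  term_mem_ordGE 1 le_rfl

theorem mul_mem_ordGE_zero {j : Fin N} {f g : Laurent N} (hf : f ∈ ordGE j 0)
    (hg : g ∈ ordGE j 0) : f * g ∈ ordGE j 0 := by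
  simpa using mul_mem_ordGE hf hg

theorem prod_mem_ordGE {j : Fin N} {ι : Type*} (s : Finset ι) (f : ι → Laurent N)
    (h : ∀ i ∈ s, f i ∈ ordGE j 0) : ∏ i ∈ s, f i ∈ ordGE j 0 :=
  Finset.prod_induction f (· ∈ ordGE j 0) (fun _ _ => mul_mem_ordGE_zero) (one_mem_ordGE j) h

theorem CT_eq_zero_of_mem_ordGE {j : Fin N} {c : ℤ} (hc : 0 < c) {f : Laurent N}
    (hf : f ∈ ordGE j c) : CT f = 0 := by
  by_contra h
  exact absurd (hf 0 h) (not_le.mpr hc)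

theorem aeval_mem_ordGE {j : Fin N} {σ : Type*} (y : σ → Laurent N) (hy : ∀ i, y i ∈ ordGE j 0)
    (p : MvPolynomial σ K) : MvPolynomial.aeval y p ∈ ordGE j 0 := by
  induction p using MvPolynomial.induction_on with
  | C c => rw [MvPolynomial.aeval_C]; exact term_mem_ordGE c le_rfl
  | add p r hp hr => rw [map_add]; exact Submodule.add_mem _ hp hr
  | mul_X p i hp => rw [map_mul, MvPolynomial.aeval_X]; exact mul_mem_ordGE_zero hp (hy i)

end Order

/-! ### Setting one variable equal to zero, as a relation between Laurent polynomials. -/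

section Embedding

variable {n : ℕ}

/-- Insertion of a zero exponent in position `j`. -/
def insertZero (j : Fin (n + 1)) : (Fin n → ℤ) →+ (Fin (n + 1) → ℤ) where
  toFun e := j.insertNth 0 e
  map_zero' := by
    ext i
    refine Fin.succAboveCases j ?_ (fun i => ?_) i <;> simp
  map_add' e f := by
    ext i
    refine Fin.succAboveCases j ?_ (fun i => ?_) i <;> simp

theorem insertZero_same (j : Fin (n + 1)) (e : Fin n → ℤ) : insertZero j e j = 0 := by
  simp [insertZero]

theorem insertZero_succAbove (j : Fin (n + 1)) (e : Fin n → ℤ) (i : Fin n) :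
    insertZero j e (j.succAbove i) = e i := by
  simp [insertZero]

theorem insertZero_injective (j : Fin (n + 1)) : Function.Injective (insertZero j) := by
  intro e f h
  ext i
  rw [← insertZero_succAbove j e, h, insertZero_succAbove]

theorem insertZero_expo (j : Fin (n + 1)) (i : Fin n) :
    insertZero j (expo i) = expo (j.succAbove i) := by
  ext k
  refine Fin.succAboveCases j ?_ (fun k => ?_) k
  · rw [insertZero_same, expo, Pi.single_eq_of_ne (Fin.succAbove_ne j i).symm]
  · rw [insertZero_succAbove, expo, expo]
    simp [Pi.single_apply]

/-- The inclusion of the Laurent polynomials that do not involve `x_j`. -/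
def emb (j : Fin (n + 1)) : Laurent n →ₐ[K] Laurent (n + 1) :=
  AddMonoidAlgebra.mapDomainAlgHom K K (insertZero j)

theorem emb_term (j : Fin (n + 1)) (c : K) (e : Fin n → ℤ) :
    emb j (term c e) = term c (insertZero j e) :=
  AddMonoidAlgebra.mapDomain_single

theorem coeff_emb (j : Fin (n + 1)) (f : Laurent n) :
    (emb j f).coeff = Finsupp.mapDomain (insertZero j) f.coeff := rfl

theorem emb_mem_ordGE (j : Fin (n + 1)) (f : Laurent n) : emb j f ∈ ordGE j 0 := by
  intro e he
  by_cases h : e ∈ Set.range (insertZero j)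
  · obtain ⟨e, rfl⟩ := h
    exact (insertZero_same j e).ge
  · rw [coeff_emb, Finsupp.mapDomain_of_notMem_range _ _ h] at he
    exact absurd rfl he

theorem CT_emb (j : Fin (n + 1)) (f : Laurent n) : CT (emb j f) = CT f := by
  rw [CT, CT, coeff_emb, ← map_zero (insertZero j),
    Finsupp.mapDomain_apply (insertZero_injective j)]

/-- `g` is the specialization of `f` at `x_j = 0`. -/
def SpecializesTo (j : Fin (n + 1)) (f : Laurent (n + 1)) (g : Laurent n) : Prop :=
  f - emb j g ∈ ordGE j 1

namespace SpecializesTo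

variable {j : Fin (n + 1)} {f f' : Laurent (n + 1)} {g g' : Laurent n}

theorem mem_ordGE (h : SpecializesTo j f g) : f ∈ ordGE j 0 := by
  rw [← sub_add_cancel f (emb j g)]
  exact Submodule.add_mem _ (ordGE_mono zero_le_one h) (emb_mem_ordGE j g)

theorem of_emb (j : Fin (n + 1)) (g : Laurent n) : SpecializesTo j (emb j g) g := by
  rw [SpecializesTo, sub_self]
  exact Submodule.zero_mem _

theorem of_mem_ordGE (h : f ∈ ordGE j 1) : SpecializesTo j f 0 := by
  rwa [SpecializesTo, map_zero, sub_zero]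

theorem one : SpecializesTo j 1 1 := by
  simpa using of_emb j 1

theorem const (c : K) :
    SpecializesTo j (algebraMap K (Laurent (n + 1)) c) (algebraMap K (Laurent n) c) := by
  have h := of_emb j (algebraMap K (Laurent n) c)
  rwa [AlgHom.commutes] at h

theorem add (h : SpecializesTo j f g) (h' : SpecializesTo j f' g') :
    SpecializesTo j (f + f') (g + g') := by
  rw [SpecializesTo, map_add, add_sub_add_comm]
  exact Submodule.add_mem _ h h'

theorem sub (h : SpecializesTo j f g) (h' : SpecializesTo j f' g') :
    SpecializesTo j (f - f') (g - g') := by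
  rw [SpecializesTo, map_sub, sub_sub_sub_comm]
  exact Submodule.sub_mem _ h h'

theorem mul (h : SpecializesTo j f g) (h' : SpecializesTo j f' g') :
    SpecializesTo j (f * f') (g * g') := by
  have e : f * f' - emb j (g * g') = (f - emb j g) * f' + emb j g * (f' - emb j g') := by
    rw [map_mul]; ring
  rw [SpecializesTo, e]
  refine Submodule.add_mem _ ?_ ?_
  · simpa using QDyson.mul_mem_ordGE h h'.mem_ordGE
  · simpa using QDyson.mul_mem_ordGE (emb_mem_ordGE j g) h'

theorem prod {ι : Type*} (s : Finset ι) {F : ι → Laurent (n + 1)} {G : ι → Laurent n}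
    (h : ∀ i, SpecializesTo j (F i) (G i)) :
    SpecializesTo j (∏ i ∈ s, F i) (∏ i ∈ s, G i) :=
  Finset.prod_hom_rel (s := s) (r := SpecializesTo j) one fun i _ _ h' => (h i).mul h'

theorem smul (c : K) (h : SpecializesTo j f g) : SpecializesTo j (c • f) (c • g) := by
  rw [SpecializesTo, map_smul, ← smul_sub]
  exact Submodule.smul_mem _ c h

theorem aeval {σ : Type*} {y : σ → Laurent (n + 1)} {z : σ → Laurent n}
    (h : ∀ i, SpecializesTo j (y i) (z i)) (p : MvPolynomial σ K) :
    SpecializesTo j (MvPolynomial.aeval y p) (MvPolynomial.aeval z p) := by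
  induction p using MvPolynomial.induction_on with
  | C c => rw [MvPolynomial.aeval_C, MvPolynomial.aeval_C]; exact const c
  | add p r hp hr => rw [map_add, map_add]; exact hp.add hr
  | mul_X p i hp =>
    rw [map_mul, map_mul, MvPolynomial.aeval_X, MvPolynomial.aeval_X]; exact hp.mul (h i)

/-- The difference has only positive powers of `x_j`, so it does not contribute. -/
theorem CT_eq (h : SpecializesTo j f g) : CT f = CT g := by
  have := CT_eq_zero_of_mem_ordGE zero_lt_one h
  rwa [CT_sub, CT_emb, sub_eq_zero] at this

end SpecializesTo

end Embedding

/-! ### Cancelling one variable's letters against a pair factor of the `q`-Dyson product. -/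

section CrossFactor

/-- The quotient of `(w; Q)_c (Q / w; Q)_b` by `∏_{k < b} (1 - Q ^ (k + 1 - t) / w)`, for
`t ≤ c`. -/
def crossFactor {R : Type*} [CommRing R] (w Q : R) (t b c : ℕ) : R :=
  (∏ k ∈ range t, (Q ^ b - w * Q ^ k)) * ∏ k ∈ Ico t c, (1 - w * Q ^ k)

theorem map_crossFactor {R S : Type*} [CommRing R] [CommRing S] (f : R →+* S) (w Q : R)
    (t b c : ℕ) : f (crossFactor w Q t b c) = crossFactor (f w) (f Q) t b c := by
  simp [crossFactor, map_prod]

/-- Induction on `t`. Raising `t` shifts the window of `b` consecutive exponents down by one; up to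
the common unit `-w Q^t`, the end factors exchanged are `Q^b - w Q^t` and `1 - w Q^t`, exactly the
change in `crossFactor`. -/
theorem crossFactor_mul {F : Type*} [Field F] {w Q : F} (hw : w ≠ 0) (hQ : Q ≠ 0) (b c : ℕ)
    {t : ℕ} (ht : t ≤ c) :
    crossFactor w Q t b c * ∏ k ∈ range b, (1 - Q ^ ((k : ℤ) + 1 - t) / w) =
      qPoch w Q c * qPoch (Q / w) Q b := by
  induction t with
  | zero =>
    rw [crossFactor, Finset.prod_range_zero, one_mul, ← Finset.range_eq_Ico]
    congr 1
    refine Finset.prod_congr rfl fun k _ => ?_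
    rw [Nat.cast_zero, sub_zero, zpow_add_one₀ hQ, zpow_natCast]
    ring
  | succ t ih =>
    rw [← ih (by omega), crossFactor, crossFactor, Finset.prod_range_succ,
      Finset.prod_eq_prod_Ico_succ_bot (show t < c by omega)]
    -- Both sides are the product of `1 - Q^e / w` over `-t ≤ e ≤ b - t`, split off at opposite
    -- ends.
    have hA : (1 - Q ^ (-(t : ℤ)) / w) * ∏ k ∈ range b, (1 - Q ^ ((k : ℤ) + 1 - t) / w) =
        (1 - Q ^ ((b : ℤ) - t) / w) *
          ∏ k ∈ range b, (1 - Q ^ ((k : ℤ) + 1 - (t + 1 : ℕ)) / w) := by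
      have h1 := Finset.prod_range_succ (fun k : ℕ => 1 - Q ^ ((k : ℤ) - t) / w) b
      rw [Finset.prod_range_succ'] at h1
      push_cast at h1 ⊢
      simp only [zero_sub, add_sub_add_right_eq_sub] at h1 ⊢
      rw [mul_comm, h1, mul_comm]
    have e1 : Q ^ b - w * Q ^ t = -(w * Q ^ t) * (1 - Q ^ ((b : ℤ) - t) / w) := by
      rw [zpow_sub₀ hQ, zpow_natCast, zpow_natCast]
      field_simp
      ring
    have e2 : 1 - w * Q ^ t = -(w * Q ^ t) * (1 - Q ^ (-(t : ℤ)) / w) := by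
      rw [zpow_neg, zpow_natCast]
      field_simp
      ring
    rw [e1, e2]
    linear_combination (-(∏ k ∈ range t, (Q ^ b - w * Q ^ k)) * -(w * Q ^ t) *
      ∏ k ∈ Ico (t + 1) c, (1 - w * Q ^ k)) * hA

theorem crossFactor_mem_ordGE {N : ℕ} {j : Fin N} {w : Laurent N} (hw : w ∈ ordGE j 0)
    (t b c : ℕ) : crossFactor w (term q 0) t b c ∈ ordGE j 0 := by
  have hQ : ∀ k, term q (0 : Fin N → ℤ) ^ k ∈ ordGE j 0 := fun k => by
    rw [term_pow]; exact term_mem_ordGE _ (by simp)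
  refine mul_mem_ordGE_zero (prod_mem_ordGE _ _ fun k _ => ?_) (prod_mem_ordGE _ _ fun k _ => ?_)
  · exact Submodule.sub_mem _ (hQ b) (mul_mem_ordGE_zero hw (hQ k))
  · exact Submodule.sub_mem _ (one_mem_ordGE j) (mul_mem_ordGE_zero hw (hQ k))

/-- At `w = 0` each of the first `t` factors becomes `q^b` and the others become `1`. -/
theorem SpecializesTo.crossFactor {n : ℕ} {j : Fin (n + 1)} {w : Laurent (n + 1)}
    (hw : w ∈ ordGE j 1) (t b c : ℕ) :
    SpecializesTo j (crossFactor w (term q 0) t b c) (algebraMap K (Laurent n) ((q ^ b) ^ t)) := by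
  have hQ : ∀ k, SpecializesTo j (term q (0 : Fin (n + 1) → ℤ) ^ k)
      (algebraMap K (Laurent n) (q ^ k)) := fun k => by
    rw [term_pow, smul_zero]; exact SpecializesTo.const _
  have hwQ : ∀ k, SpecializesTo j (w * term q (0 : Fin (n + 1) → ℤ) ^ k) 0 := fun k => by
    simpa using (SpecializesTo.of_mem_ordGE hw).mul (hQ k)
  have h1 := SpecializesTo.prod (range t) fun k => (hQ b).sub (hwQ k)
  have h2 := SpecializesTo.prod (Ico t c) fun k => SpecializesTo.one.sub (hwQ k)
  have h := h1.mul h2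
  simp only [sub_zero, Finset.prod_const, Finset.card_range, one_pow, mul_one, ← map_pow] at h
  exact h

end CrossFactor

/-! ### Separating one variable, or one letter, from a product. -/

section Splitting

theorem prod_lt_succAbove {M : Type*} [CommMonoid M] {n : ℕ}
    (f : Fin (n + 1) → Fin (n + 1) → M) (j : Fin (n + 1)) :
    ∏ i, ∏ k ∈ univ.filter (fun k => i < k), f i k =
      (∏ i : Fin n, if j.succAbove i < j then f (j.succAbove i) j else f j (j.succAbove i)) *
        ∏ i, ∏ k ∈ univ.filter (fun k => i < k), f (j.succAbove i) (j.succAbove k) := by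
  simp only [Finset.prod_filter]
  rw [Fin.prod_univ_succAbove _ j]
  simp only [Fin.prod_univ_succAbove _ j, lt_irrefl, if_false, one_mul,
    Fin.succAbove_lt_succAbove_iff]
  rw [Finset.prod_mul_distrib, ← mul_assoc, ← Finset.prod_mul_distrib]
  congr 1
  refine Finset.prod_congr rfl fun i _ => ?_
  rcases lt_or_gt_of_ne (Fin.succAbove_ne j i) with h | h
  · rw [if_neg (not_lt.mpr h.le), if_pos h, if_pos h, one_mul]
  · rw [if_pos h, if_neg (not_lt.mpr h.le), if_neg (not_lt.mpr h.le), mul_one]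

theorem prod_sigma_erase {M : Type*} [CommMonoid M] {n : ℕ} {a : Fin (n + 1) → ℕ}
    (f : (Σ i, Fin (a i)) → M) (j : Fin (n + 1)) (l : Fin (a j)) :
    ∏ p ∈ univ.erase (⟨j, l⟩ : Σ i, Fin (a i)), f p =
      (∏ k ∈ univ.erase l, f ⟨j, k⟩) * ∏ i : Fin n, ∏ k, f ⟨j.succAbove i, k⟩ := by
  have h : ∀ {ι : Type} [Fintype ι] [DecidableEq ι] (g : ι → M) (x : ι),
      ∏ p ∈ univ.erase x, g p = ∏ p, if p = x then 1 else g p := by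
    intro ι _ _ g x
    rw [← Finset.mul_prod_erase univ (fun p => if p = x then 1 else g p) (mem_univ x), if_pos rfl,
      one_mul]
    exact Finset.prod_congr rfl fun p hp => (if_neg (Finset.ne_of_mem_erase hp)).symm
  rw [h, h, Fintype.prod_sigma, Fin.prod_univ_succAbove _ j]
  congr 1
  · exact Finset.prod_congr rfl fun k _ => by simp
  · refine Finset.prod_congr rfl fun i _ => Finset.prod_congr rfl fun k _ => if_neg fun hk => ?_
    exact Fin.succAbove_ne j i (congrArg Sigma.fst hk)

theorem map_dysonProd {N : ℕ} {R : Type*} [CommRing R] (f : Laurent N →+* R) (a : Fin N → ℕ) :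
    f (dysonProd a) = ∏ i : Fin N, ∏ j ∈ univ.filter (fun j : Fin N => i < j),
      (qPoch (f (term 1 (expo i - expo j))) (f (term q 0)) (a i) *
        qPoch (f (term q (expo j - expo i))) (f (term q 0)) (a j)) := by
  simp only [dysonProd, map_prod, map_mul, map_qPoch]

end Splitting

/-! ### The `q`-Dyson product divided by a partial fraction denominator. -/

section LetterQuotient

variable {n : ℕ}

/-- The indicator function of `i < m`. -/
def chi (m : ℕ) {N : ℕ} (i : Fin N) : ℕ := if i.val < m then 1 else 0

theorem alphabet_apply {N : ℕ} (a : Fin N → ℕ) (m : ℕ) (p : Σ i : Fin N, Fin (a i)) :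
    alphabet a m p = term (q ^ ((p.2.val : ℤ) - chi m p.1)) (expo p.1) := by
  rw [alphabet, chi]; push_cast; rfl

/-- The monomial by which the variables `x_j` and `x_i` interact. -/
def crossMonomial (j i : Fin (n + 1)) : Laurent (n + 1) :=
  term (if i < j then q else 1) (expo j - expo i)

/-- The offset between the letters `x_i q ^ k` and the letter at `(j, l)`. -/
def offset (m : ℕ) (j i : Fin (n + 1)) (l : ℕ) : ℕ :=
  l + chi m i + (if i < j then 0 else 1) - chi m j

theorem offset_cast (m : ℕ) {j i : Fin (n + 1)} (l : ℕ) :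
    (offset m j i l : ℤ) = l + chi m i + (if i < j then 0 else 1) - chi m j := by
  have : chi m j ≤ l + chi m i + (if i < j then 0 else 1) := by
    unfold chi
    by_cases h : i < j
    · have : i.val < j.val := h
      split_ifs <;> omega
    · split_ifs <;> omega
  rw [offset, Nat.cast_sub this]
  push_cast
  rfl

/-- This bound, which `crossFactor_mul` needs, holds because `chi m` is weakly decreasing in the
index: the shifted letters belong to an initial segment of the variables. -/
theorem offset_le (m : ℕ) {j i : Fin (n + 1)} {l c : ℕ} (hij : i ≠ j) (hl : l < c) :
    offset m j i l ≤ c := by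
  unfold offset chi
  rcases lt_or_gt_of_ne hij with h | h
  · rw [if_pos h]
    split_ifs <;> omega
  · have h' : j.val < i.val := h
    rw [if_neg (not_lt.mpr h.le)]
    split_ifs <;> omega

/-- The quotient of the `q`-Dyson product by `∏ (1 - y' / y)`, where `y` is the letter at `(j, l)`
and `y'` ranges over the other letters. -/
def letterQuotient (a : Fin (n + 1) → ℕ) (m : ℕ) (j : Fin (n + 1)) (l : Fin (a j)) :
    Laurent (n + 1) :=
  (∏ k ∈ univ.erase l, (1 - q ^ ((k : ℤ) - (l : ℤ))))⁻¹ •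
    ((∏ i : Fin n, crossFactor (crossMonomial j (j.succAbove i)) (term q 0)
        (offset m j (j.succAbove i) l) (a (j.succAbove i)) (a j)) *
      emb j (dysonProd fun i => a (j.succAbove i)))

theorem crossMonomial_mem_ordGE {j i : Fin (n + 1)} (h : i ≠ j) :
    crossMonomial j i ∈ ordGE j 1 :=
  term_mem_ordGE _ (by simp [expo, Pi.single_eq_of_ne h.symm])

theorem letterQuotient_mem_ordGE (a : Fin (n + 1) → ℕ) (m : ℕ) (j : Fin (n + 1)) (l : Fin (a j)) :
    letterQuotient a m j l ∈ ordGE j 0 := by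
  refine Submodule.smul_mem _ _ (mul_mem_ordGE_zero (prod_mem_ordGE _ _ fun i _ => ?_)
    (emb_mem_ordGE j _))
  exact crossFactor_mem_ordGE
    (ordGE_mono zero_le_one (crossMonomial_mem_ordGE (Fin.succAbove_ne j i))) _ _ _

theorem SpecializesTo.letterQuotient (a : Fin (n + 1) → ℕ) (m : ℕ) (j : Fin (n + 1))
    (l : Fin (a j)) :
    SpecializesTo j (letterQuotient a m j l)
      (((∏ k ∈ univ.erase l, (1 - q ^ ((k : ℤ) - (l : ℤ))))⁻¹ *
        ∏ i, (q ^ a (j.succAbove i)) ^ offset m j (j.succAbove i) l) •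
          dysonProd fun i => a (j.succAbove i)) := by
  have h := SpecializesTo.smul (∏ k ∈ univ.erase l, (1 - q ^ ((k : ℤ) - (l : ℤ))))⁻¹
    ((SpecializesTo.prod univ fun i : Fin n => SpecializesTo.crossFactor
      (crossMonomial_mem_ordGE (Fin.succAbove_ne j i)) (offset m j (j.succAbove i) l)
      (a (j.succAbove i)) (a j)).mul (SpecializesTo.of_emb j
        (dysonProd fun i => a (j.succAbove i))))
  rw [← map_prod, ← Algebra.smul_def, smul_smul] at h
  exact h

theorem alphabet_injective {N : ℕ} (a : Fin N → ℕ) (m : ℕ) :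
    Function.Injective (alphabet a m) := by
  rintro ⟨i, k⟩ ⟨j, l⟩ h
  rw [alphabet_apply, alphabet_apply] at h
  obtain ⟨he, hq⟩ := term_injective (zpow_ne_zero _ q_ne_zero) h
  have hij : i = j := by
    by_contra hij
    have := congrFun he i
    simp [expo, Pi.single_eq_of_ne hij] at this
  subst hij
  have := q_zpow_injective hq
  have hkl : k = l := Fin.ext (by simpa using this)
  rw [hkl]

theorem alphabet_ne_zero {N : ℕ} (a : Fin N → ℕ) (m : ℕ) (p : Σ i : Fin N, Fin (a i)) :
    alphabet a m p ≠ 0 := by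
  rw [alphabet_apply]
  exact term_ne_zero (zpow_ne_zero _ q_ne_zero) _

theorem alphabet_mem_ordGE {N : ℕ} (a : Fin N → ℕ) (m : ℕ) (p : Σ i : Fin N, Fin (a i))
    (j : Fin N) : alphabet a m p ∈ ordGE j 0 := by
  refine term_mem_ordGE _ ?_
  rw [expo, Pi.single_apply]
  split_ifs <;> simp

section Field

variable {F : Type*} [Field F] {N : ℕ} (φ : Laurent N →+* F)

theorem map_term_ne_zero {d : K} (hd : d ≠ 0) (f : Fin N → ℤ) : φ (term d f) ≠ 0 := by
  intro h
  have h1 : φ (term d f * term d⁻¹ (-f)) = 0 := by rw [map_mul, h, zero_mul]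
  rw [term_mul_term, mul_inv_cancel₀ hd, add_neg_cancel, term_one_zero, map_one] at h1
  exact one_ne_zero h1

theorem map_term_div {c d : K} (hd : d ≠ 0) (e f : Fin N → ℤ) :
    φ (term c e) / φ (term d f) = φ (term (c / d) (e - f)) := by
  rw [div_eq_iff (map_term_ne_zero φ hd f), ← map_mul, term_mul_term, div_mul_cancel₀ _ hd, sub_add_cancel]

theorem map_term_q_zpow (z : ℤ) : φ (term q 0) ^ z = φ (term (q ^ z) 0) :=
  (map_zpow₀ (φ.comp (algebraMap K (Laurent N))) q z).symm

end Field

/-- Letters sharing `x_j` contribute only constants to the denominator. Those in another `x_i` form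
a window of consecutive powers of `q` that cancels inside the pair factor of `i` and `j`. Pairs
avoiding `j` are untouched. The map `φ` to a field makes the divisions meaningful. -/
theorem map_letterQuotient_mul {F : Type*} [Field F] (φ : Laurent (n + 1) →+* F)
    (a : Fin (n + 1) → ℕ) (m : ℕ) (j : Fin (n + 1)) (l : Fin (a j)) :
    φ (letterQuotient a m j l) * ∏ p ∈ univ.erase (⟨j, l⟩ : Σ i, Fin (a i)),
      (1 - φ (alphabet a m p) / φ (alphabet a m ⟨j, l⟩)) = φ (dysonProd a) := by
  have hdiff : ∏ k ∈ univ.erase l, (1 - φ (alphabet a m ⟨j, k⟩) / φ (alphabet a m ⟨j, l⟩)) =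
      φ (algebraMap K _ (∏ k ∈ univ.erase l, (1 - q ^ ((k : ℤ) - (l : ℤ))))) := by
    rw [map_prod, map_prod]
    refine Finset.prod_congr rfl fun k _ => ?_
    rw [alphabet_apply, alphabet_apply, map_term_div φ (zpow_ne_zero _ q_ne_zero), sub_self,
      ← zpow_sub₀ q_ne_zero, sub_sub_sub_cancel_right, map_sub, map_sub, map_one, map_one]
    rfl
  have hne : ∏ k ∈ univ.erase l, (1 - q ^ ((k : ℤ) - (l : ℤ))) ≠ 0 := by
    refine Finset.prod_ne_zero_iff.mpr fun k hk => sub_ne_zero.mpr fun h => ?_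
    have := q_zpow_eq_one h.symm
    exact Finset.ne_of_mem_erase hk (Fin.ext (by omega))
  have hc : ∀ i : Fin (n + 1), (if i < j then q else 1) ≠ 0 := fun i => by
    split_ifs
    · exact q_ne_zero
    · exact one_ne_zero
  -- The ratio of the letters `(i, k)` and `(j, l)` is `q^{k + 1 - t} / w`, with `w` the cross
  -- monomial and `t` the offset.
  have hcross : ∀ i, i ≠ j → ∏ k : Fin (a i),
      (1 - φ (alphabet a m ⟨i, k⟩) / φ (alphabet a m ⟨j, l⟩)) = ∏ k ∈ range (a i),
        (1 - φ (term q 0) ^ ((k : ℤ) + 1 - offset m j i l) / φ (crossMonomial j i)) := by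
    intro i hi
    rw [← Fin.prod_univ_eq_prod_range
      (fun k => 1 - φ (term q 0) ^ ((k : ℤ) + 1 - offset m j i l) / φ (crossMonomial j i))]
    refine Finset.prod_congr rfl fun k _ => ?_
    rw [alphabet_apply, alphabet_apply, map_term_div φ (zpow_ne_zero _ q_ne_zero),
      map_term_q_zpow, crossMonomial, map_term_div φ (hc i), zero_sub, neg_sub,
      ← zpow_sub₀ q_ne_zero, offset_cast]
    congr 3
    split_ifs
    · rw [div_eq_mul_inv, ← zpow_sub_one₀ q_ne_zero]
      congr 1
      ring
    · rw [div_one]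
      congr 1
      ring
  -- The extra `q` in the cross monomial for `i < j` brings both orientations of a pair to the same
  -- form.
  have hpair : ∀ i, i ≠ j → (if i < j then
        qPoch (φ (term 1 (expo i - expo j))) (φ (term q 0)) (a i) *
          qPoch (φ (term q (expo j - expo i))) (φ (term q 0)) (a j)
      else qPoch (φ (term 1 (expo j - expo i))) (φ (term q 0)) (a j) *
          qPoch (φ (term q (expo i - expo j))) (φ (term q 0)) (a i)) =
      qPoch (φ (crossMonomial j i)) (φ (term q 0)) (a j) *
        qPoch (φ (term q 0) / φ (crossMonomial j i)) (φ (term q 0)) (a i) := by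
    intro i hi
    unfold crossMonomial
    split_ifs
    · rw [map_term_div φ q_ne_zero, div_self q_ne_zero, zero_sub, neg_sub, mul_comm]
    · rw [map_term_div φ one_ne_zero, div_one, zero_sub, neg_sub]
  have hemb := map_dysonProd (φ.comp (emb j : Laurent n →+* Laurent (n + 1)))
    (fun i => a (j.succAbove i))
  simp only [RingHom.comp_apply, RingHom.coe_coe, emb_term, map_sub, map_zero,
    insertZero_expo] at hemb
  rw [map_dysonProd φ a, prod_lt_succAbove _ j, prod_sigma_erase, hdiff, letterQuotient,
    Algebra.smul_def, map_mul, map_mul, hemb, map_prod]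
  have hinv : φ (algebraMap K _ (∏ k ∈ univ.erase l, (1 - q ^ ((k : ℤ) - (l : ℤ))))⁻¹) *
      φ (algebraMap K _ (∏ k ∈ univ.erase l, (1 - q ^ ((k : ℤ) - (l : ℤ))))) = 1 := by
    rw [← map_mul, ← map_mul, inv_mul_cancel₀ hne, map_one, map_one]
  have hmain : (∏ i : Fin n, φ (crossFactor (crossMonomial j (j.succAbove i)) (term q 0)
        (offset m j (j.succAbove i) l) (a (j.succAbove i)) (a j))) *
      ∏ i : Fin n, ∏ k : Fin (a (j.succAbove i)),
        (1 - φ (alphabet a m ⟨j.succAbove i, k⟩) / φ (alphabet a m ⟨j, l⟩)) =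
      ∏ i : Fin n, if j.succAbove i < j then
        qPoch (φ (term 1 (expo (j.succAbove i) - expo j))) (φ (term q 0)) (a (j.succAbove i)) *
          qPoch (φ (term q (expo j - expo (j.succAbove i)))) (φ (term q 0)) (a j)
      else qPoch (φ (term 1 (expo j - expo (j.succAbove i)))) (φ (term q 0)) (a j) *
          qPoch (φ (term q (expo (j.succAbove i) - expo j))) (φ (term q 0))
            (a (j.succAbove i)) := by
    rw [← Finset.prod_mul_distrib]
    refine Finset.prod_congr rfl fun i _ => ?_
    have hi := Fin.succAbove_ne j i
    have hQ : φ (term q 0) ≠ 0 := map_term_ne_zero φ q_ne_zero 0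
    have hw : φ (crossMonomial j (j.succAbove i)) ≠ 0 := map_term_ne_zero φ (hc _) _
    rw [hpair _ hi, hcross _ hi, map_crossFactor,
      crossFactor_mul hw hQ _ _ (offset_le m hi l.isLt)]
  rw [← hmain]
  linear_combination (∏ i : Fin n, φ (crossFactor (crossMonomial j (j.succAbove i)) (term q 0)
        (offset m j (j.succAbove i) l) (a (j.succAbove i)) (a j))) *
      (∏ i : Fin n, ∏ k : Fin (a (j.succAbove i)),
        (1 - φ (alphabet a m ⟨j.succAbove i, k⟩) / φ (alphabet a m ⟨j, l⟩))) *
      (∏ i : Fin n, ∏ k ∈ univ.filter (fun k => i < k),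
        (qPoch (φ (term 1 (expo (j.succAbove i) - expo (j.succAbove k)))) (φ (term q 0))
            (a (j.succAbove i)) *
          qPoch (φ (term q (expo (j.succAbove k) - expo (j.succAbove i)))) (φ (term q 0))
            (a (j.succAbove k)))) * hinv

end LetterQuotient

/-! ### Complete symmetric functions of the `q`-Dyson alphabet. -/

section CompleteSymmetricAlphabet

/-- The value `h_r(x_m^{(a)})`. -/
def hLetter {N : ℕ} (a : Fin N → ℕ) (m r : ℕ) : Laurent N :=
  MvPolynomial.aeval (alphabet a m) (MvPolynomial.hsymm (Σ i : Fin N, Fin (a i)) K r)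

theorem hAlphabet_plus {N : ℕ} (v a : Fin N → ℕ) (m : ℕ) :
    hAlphabet a m (plus v) = ∏ i, hLetter a m (v i) := by
  -- Dropping the zero parts is harmless since `h_0 = 1`.
  have h : ∀ s : Multiset ℕ, ((s.filter (· ≠ 0)).map
      (MvPolynomial.hsymm (Σ i : Fin N, Fin (a i)) K)).prod =
        (s.map (MvPolynomial.hsymm (Σ i : Fin N, Fin (a i)) K)).prod := by
    intro s
    induction s using Multiset.induction_on with
    | empty => rfl
    | cons x s ih =>
      by_cases hx : x = 0
      · rw [Multiset.filter_cons_of_neg (p := (· ≠ 0)) _ (not_not.mpr hx), ih, Multiset.map_cons,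
          Multiset.prod_cons, hx, MvPolynomial.hsymm_zero, one_mul]
      · rw [Multiset.filter_cons_of_pos (p := (· ≠ 0)) _ hx, Multiset.map_cons, Multiset.map_cons,
          Multiset.prod_cons, Multiset.prod_cons, ih]
  have h' := h (Multiset.map v univ.val)
  rw [Multiset.map_map] at h'
  rw [hAlphabet, MvPolynomial.hsymmPart]
  refine (congrArg (MvPolynomial.aeval (alphabet a m)) h').trans ?_
  exact map_prod (MvPolynomial.aeval (alphabet a m))
    (fun i => MvPolynomial.hsymm (Σ i : Fin N, Fin (a i)) K (v i)) univ

theorem hLetter_mem_ordGE {N : ℕ} (a : Fin N → ℕ) (m r : ℕ) (j : Fin N) :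
    hLetter a m r ∈ ordGE j 0 :=
  aeval_mem_ordGE _ (fun p => alphabet_mem_ordGE a m p j) _

/-- The partial fraction expansion holds in the fraction field; once denominators are absorbed into
the `q`-Dyson product, both sides lie in the Laurent ring, which embeds. The hypothesis `hr`
excludes `h_0` of an empty alphabet. -/
theorem hLetter_mul_dysonProd {n : ℕ} (a : Fin (n + 1) → ℕ) (m r : ℕ)
    (hr : 0 < r ∨ 0 < a 0) :
    hLetter a m r * dysonProd a =
      ∑ p : Σ i, Fin (a i), alphabet a m p ^ r * letterQuotient a m p.1 p.2 := by
  have hinj : Function.Injective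
      (algebraMap (Laurent (n + 1)) (FractionRing (Laurent (n + 1)))) :=
    IsFractionRing.injective _ _
  have hinj' : Function.Injective fun p => algebraMap (Laurent (n + 1))
      (FractionRing (Laurent (n + 1))) (alphabet a m p) :=
    hinj.comp (alphabet_injective a m)
  have h0 : ∀ p, algebraMap (Laurent (n + 1)) (FractionRing (Laurent (n + 1)))
      (alphabet a m p) ≠ 0 := fun p h =>
    alphabet_ne_zero a m p (hinj (h.trans (map_zero _).symm))
  apply hinj
  have hne : 0 < r ∨ Nonempty (Σ i, Fin (a i)) := hr.imp_right fun h => ⟨⟨0, ⟨0, h⟩⟩⟩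
  have hh : algebraMap (Laurent (n + 1)) (FractionRing (Laurent (n + 1))) (hLetter a m r) =
      MvPolynomial.aeval (fun p => algebraMap (Laurent (n + 1))
        (FractionRing (Laurent (n + 1))) (alphabet a m p))
        (MvPolynomial.hsymm (Σ i, Fin (a i)) K r) :=
    (MvPolynomial.aeval_algebraMap_apply _ _ _).symm
  rw [map_mul, hh, aeval_hsymm_partialFractions _ hinj' h0 r hne, Finset.sum_mul, map_sum]
  refine Finset.sum_congr rfl fun p _ => ?_
  rw [← map_letterQuotient_mul _ a m p.1 p.2, map_mul, map_pow]
  have hp : ∏ k ∈ univ.erase p, (1 - algebraMap (Laurent (n + 1))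
      (FractionRing (Laurent (n + 1))) (alphabet a m k) / algebraMap (Laurent (n + 1))
      (FractionRing (Laurent (n + 1))) (alphabet a m p)) ≠ 0 := by
    refine Finset.prod_ne_zero_iff.mpr fun k hk h => ?_
    rw [sub_eq_zero, eq_div_iff (h0 p), one_mul] at h
    exact Finset.ne_of_mem_erase hk (hinj' h.symm)
  field_simp

/-- The letters in `x_0` become zero and drop out of the generating series; renumbering the
remaining variables turns `m` into `m - 1`. -/
theorem SpecializesTo.hLetter {n : ℕ} (a : Fin (n + 1) → ℕ) (m r : ℕ) (hm : 1 ≤ m) :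
    SpecializesTo 0 (hLetter a m r) (hLetter (fun i : Fin n => a i.succ) (m - 1) r) := by
  have hchi : ∀ i : Fin n, chi m i.succ = chi (m - 1) i := fun i => by
    unfold chi
    rw [Fin.val_succ]
    congr 1
    exact propext (by omega)
  have hs : ∀ p : Σ i : Fin (n + 1), Fin (a i), SpecializesTo 0 (alphabet a m p)
      ((Fin.cases (motive := fun i => Fin (a i) → Laurent n) (fun _ => 0)
        (fun i k => alphabet (fun i : Fin n => a i.succ) (m - 1) ⟨i, k⟩) p.1 : _) p.2) := by
    rintro ⟨i, k⟩
    refine Fin.cases (motive := fun i => ∀ k : Fin (a i), SpecializesTo 0 (alphabet a m ⟨i, k⟩)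
      ((Fin.cases (motive := fun i => Fin (a i) → Laurent n) (fun _ => 0)
        (fun i k => alphabet (fun i : Fin n => a i.succ) (m - 1) ⟨i, k⟩) i : _) k))
      (fun k => ?_) (fun i k => ?_) i k
    · rw [alphabet_apply]
      exact SpecializesTo.of_mem_ordGE (term_mem_ordGE _ (by simp [expo]))
    · rw [alphabet_apply, hchi]
      have h := SpecializesTo.of_emb 0
        (alphabet (fun i : Fin n => a i.succ) (m - 1) ⟨i, k⟩)
      rw [alphabet_apply, emb_term, insertZero_expo, Fin.zero_succAbove] at h
      rw [Fin.cases_succ, alphabet_apply]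
      exact h
  have h := SpecializesTo.aeval hs (MvPolynomial.hsymm (Σ i : Fin (n + 1), Fin (a i)) K r)
  rw [aeval_hsymm_eq_of_prod_eq _ (alphabet (fun i : Fin n => a i.succ) (m - 1))] at h
  · exact h
  · rw [Fintype.prod_sigma, Fintype.prod_sigma, Fin.prod_univ_succ]
    simp

end CompleteSymmetricAlphabet

/-! ### Constant terms of the individual partial fractions. -/

section Recursion

variable {n : ℕ}

/-- The letter's power against `x^{-v}` leaves `x_j^{v_0 - v_j}` with positive exponent, and no
other factor has negative order in `x_j`. -/
theorem CT_letter_eq_zero (v a : Fin (n + 1) → ℕ) (m : ℕ) {j : Fin (n + 1)} (hj : v j < v 0)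
    (l : Fin (a j)) {f : Laurent (n + 1)} (hf : f ∈ ordGE j 0) :
    CT (term 1 (-fun i => (v i : ℤ)) *
      (alphabet a m ⟨j, l⟩ ^ v 0 * letterQuotient a m j l) * f) = 0 := by
  have h : term 1 (-fun i => (v i : ℤ)) * alphabet a m ⟨j, l⟩ ^ v 0 ∈
      ordGE j ((v 0 : ℤ) - v j) := by
    rw [alphabet_apply, term_pow, term_mul_term]
    refine term_mem_ordGE _ (le_of_eq ?_)
    simp [expo]
    ring
  have h' := mul_mem_ordGE (mul_mem_ordGE h (letterQuotient_mem_ordGE a m j l)) hf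
  rw [add_zero, add_zero] at h'
  rw [← mul_assoc]
  exact CT_eq_zero_of_mem_ordGE (by omega) h'

theorem CT_letter_zero (v a : Fin (n + 1) → ℕ) {m : ℕ} (hm : 1 ≤ m) (l : Fin (a 0))
    {f : Laurent (n + 1)} {g : Laurent n} (hf : SpecializesTo 0 f g) :
    CT (term 1 (-fun i => (v i : ℤ)) *
      (alphabet a m ⟨0, l⟩ ^ v 0 * letterQuotient a m 0 l) * f) =
    q ^ ((∑ i : Fin n, (a i.succ : ℤ) * chi m i.succ) - v 0) *
      ((∏ k ∈ univ.erase l, (1 - q ^ ((k : ℤ) - (l : ℤ))))⁻¹ *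
        (q ^ (l : ℕ)) ^ (v 0 + ∑ i : Fin n, a i.succ)) *
      CT (term 1 (-fun i : Fin n => (v i.succ : ℤ)) * g * dysonProd fun i : Fin n => a i.succ) := by
  have hmono : SpecializesTo 0 (term 1 (-fun i => (v i : ℤ)) * alphabet a m ⟨0, l⟩ ^ v 0)
      ((q ^ ((l : ℤ) - 1)) ^ v 0 • term 1 (-fun i : Fin n => (v i.succ : ℤ))) := by
    have h := SpecializesTo.smul ((q ^ ((l : ℤ) - 1)) ^ v 0)
      (SpecializesTo.of_emb 0 (term 1 (-fun i : Fin n => (v i.succ : ℤ))))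
    have hc : chi m (0 : Fin (n + 1)) = 1 := if_pos hm
    -- The power `x_0^{v_0}` of the letter cancels `x_0^{-v_0}` exactly, so `x_0 = 0` may be
    -- substituted.
    have he : (-fun i => (v i : ℤ)) + v 0 • expo (0 : Fin (n + 1)) =
        insertZero 0 (-fun i : Fin n => (v i.succ : ℤ)) := by
      ext i
      refine Fin.cases ?_ (fun i => ?_) i
      · simp [expo, insertZero]
      · have := insertZero_succAbove 0 (-fun i : Fin n => (v i.succ : ℤ)) i
        rw [Fin.zero_succAbove] at this
        rw [this]
        simp [expo]
    rw [alphabet_apply, term_pow, term_mul_term, he, hc, one_mul, Nat.cast_one]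
    rw [emb_term, term, AddMonoidAlgebra.smul_single, smul_eq_mul, mul_one] at h
    exact h
  -- Exponents: `(l - 1) v_0 + ∑ a_i (l + χ_i) = (∑ a_i χ_i - v_0) + l (v_0 + ∑ a_i)`, sums over `i
  -- ≥ 1`. Only the last term depends on `l`.
  have hq : (q ^ ((l : ℤ) - 1)) ^ v 0 * ∏ i : Fin n, (q ^ a i.succ) ^ (l + chi m i.succ) =
      q ^ ((∑ i : Fin n, (a i.succ : ℤ) * chi m i.succ) - v 0) *
        (q ^ (l : ℕ)) ^ (v 0 + ∑ i : Fin n, a i.succ) := by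
    have h1 : ∏ i : Fin n, (q ^ a i.succ) ^ ((l : ℕ) + chi m i.succ) =
        q ^ (∑ i : Fin n, a i.succ * ((l : ℕ) + chi m i.succ)) := by
      rw [← Finset.prod_pow_eq_pow_sum]
      exact Finset.prod_congr rfl fun i _ => (pow_mul _ _ _).symm
    rw [h1, ← pow_mul, ← zpow_natCast, ← zpow_natCast, ← zpow_natCast, ← zpow_mul,
      ← zpow_add₀ q_ne_zero, ← zpow_add₀ q_ne_zero]
    congr 1
    push_cast
    simp only [mul_add, Finset.sum_add_distrib, ← Finset.sum_mul]
    ring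
  -- The `1` for `i > 0` cancels the shift `chi m 0 = 1`, which is where `m ≥ 1` enters.
  have hoff : ∀ i : Fin n, offset m 0 i.succ l = l + chi m i.succ := fun i => by
    have hc : chi m (0 : Fin (n + 1)) = 1 := if_pos hm
    rw [offset, hc, if_neg (Fin.not_lt_zero _)]
    omega
  have hlq := SpecializesTo.letterQuotient a m 0 l
  simp only [Fin.zero_succAbove, hoff] at hlq
  rw [← mul_assoc, ((hmono.mul hlq).mul hf).CT_eq, smul_mul_smul_comm, smul_mul_assoc, CT_smul,
    mul_right_comm (term 1 _) _ g]
  linear_combination ((∏ k ∈ univ.erase l, (1 - q ^ ((k : ℤ) - (l : ℤ))))⁻¹ *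
    CT (term 1 (-fun i : Fin n => (v i.succ : ℤ)) * g * dysonProd fun i : Fin n => a i.succ)) * hq

end Recursion

end QDyson

end

/-! ### The recursion. -/

open QDyson Finset in
theorem theorem5p1 (n : ℕ) (v a : Fin (n + 1) → ℕ) (m : ℕ)
    (hm1 : 1 ≤ m) (hm2 : m ≤ n + 1)
    (hv : ∀ i : Fin (n + 1), i ≠ 0 → v i < v 0)
    (h0 : 0 < v 0 ∨ 0 < a 0) :
    QDyson.D (fun i => (v i : ℤ)) (QDyson.plus v) a m =
      QDyson.q ^ ((∑ i ∈ Finset.univ.filter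
          (fun i : Fin (n + 1) => 1 ≤ i.val ∧ i.val ≤ m - 1), (a i : ℤ)) - (v 0 : ℤ)) *
        QDyson.qBinom ((v 0 : ℤ) + (∑ i, (a i : ℤ)) - 1) ((a 0 : ℤ) - 1) *
        QDyson.D (fun i : Fin n => (v i.succ : ℤ)) (QDyson.plus (fun i : Fin n => v i.succ))
          (fun i : Fin n => a i.succ) (m - 1) := by
  have hexp : ∑ i ∈ univ.filter (fun i : Fin (n + 1) => 1 ≤ i.val ∧ i.val ≤ m - 1), (a i : ℤ) =
      ∑ i : Fin n, (a i.succ : ℤ) * chi m i.succ := by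
    rw [Finset.sum_filter, Fin.sum_univ_succ, if_neg (by simp), zero_add]
    refine Finset.sum_congr rfl fun i _ => ?_
    rw [chi]
    simp only [Fin.val_succ]
    by_cases h : i.val + 1 < m
    · rw [if_pos ⟨by omega, by omega⟩, if_pos h, Nat.cast_one, mul_one]
    · rw [if_neg (by omega), if_neg h, Nat.cast_zero, mul_zero]
  have hD : D (fun i => (v i : ℤ)) (plus v) a m =
      ∑ p : Σ i, Fin (a i), CT (term 1 (-fun i => (v i : ℤ)) *
        (alphabet a m p ^ v 0 * letterQuotient a m p.1 p.2) *
          ∏ i : Fin n, hLetter a m (v i.succ)) := by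
    rw [D, hAlphabet_plus, Fin.prod_univ_succ, ← CT_sum, ← Finset.sum_mul, ← Finset.mul_sum,
      ← hLetter_mul_dysonProd a m (v 0) h0]
    simp only [mul_assoc, mul_comm (dysonProd a)]
  have hD' : D (fun i : Fin n => (v i.succ : ℤ)) (plus fun i : Fin n => v i.succ)
      (fun i : Fin n => a i.succ) (m - 1) =
      CT (term 1 (-fun i : Fin n => (v i.succ : ℤ)) *
        (∏ i : Fin n, hLetter (fun i : Fin n => a i.succ) (m - 1) (v i.succ)) *
        dysonProd fun i : Fin n => a i.succ) := by
    rw [D, hAlphabet_plus]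
  have hcast : (v 0 : ℤ) + ∑ i, (a i : ℤ) - 1 =
      ((v 0 + ∑ i : Fin n, a i.succ : ℕ) : ℤ) + (a 0 : ℤ) - 1 := by
    rw [Fin.sum_univ_succ]
    push_cast
    ring
  -- Strict maximality of `v_0` removes every letter outside `x_0`.
  have hzero : ∑ i : Fin n, ∑ l : Fin (a i.succ), CT (term 1 (-fun i => (v i : ℤ)) *
      (alphabet a m ⟨i.succ, l⟩ ^ v 0 * letterQuotient a m i.succ l) *
        ∏ i : Fin n, hLetter a m (v i.succ)) = 0 :=
    Finset.sum_eq_zero fun i _ => Finset.sum_eq_zero fun l _ =>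
      CT_letter_eq_zero v a m (hv i.succ (Fin.succ_ne_zero i)) l
        (prod_mem_ordGE _ _ fun _ _ => hLetter_mem_ordGE _ _ _ _)
  have hf := SpecializesTo.prod univ fun i : Fin n => SpecializesTo.hLetter a m (v i.succ) hm1
  rw [hD, Fintype.sum_sigma, Fin.sum_univ_succ, hzero, add_zero,
    Finset.sum_congr rfl fun l _ => CT_letter_zero v a hm1 l hf, ← Finset.sum_mul,
    ← Finset.mul_sum, sum_q_powers_eq_qBinom, hexp, hcast, hD']
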